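/- Consider two bodies of masses $\mu_1,\mu_2>0$ on the unit sphere in $\mathbb R^3$, at geodesic distance $q\in(0,\pi)$, interacting through the repelling potential $V(q)=\cot q$. In a body frame in which the bodies are at $\mathbf x_1=(0,0,-1)$ and $\mathbf x_2(q)=(0,\sin q,-\cos q)$, and with body angular velocity $\omega=(\omega_1,\omega_2,\omega_3)$, the kinetic energy is $\tfrac12 \mathbf v^T\mathbb M(q)\mathbf v$, where $\mathbf v=(\dot q,\omega_1,\omega_2,\omega_3)^T$ and $$\mathbb M(q)=\begin{pmatrix}\mu_2&\mu_2&0&0\\ \mu_2&\mu_1+\mu_2&0&0\\ 0&0&\mu_1+\mu_2\cos^2q&\mu_2\sin q\cos q\\ 0&0&\mu_2\sin q\cos q&\mu_2\sin^2q\end{pmatrix}.$$ After reduction by $SO(3)$ the phase space is $P=T^*(0,\pi)\times\mathfrak{so}(3)^*$ with coordinates $(q,p,\mathbf m)$, where $(p,\mathbf m)^T=\mathbb M(q)\mathbf v$. The reduced Hamiltonian is $$H(q,p,\mathbf m)=\tfrac12\,\mathbf u^T\mathbb M(q)^{-1}\mathbf u+\cot q,\qquad \mathbf u=(p,m_1,m_2,m_3)^T,$$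 and the reduced equations are $\dot q=H_p$, $\dot p=-H_q$, $\dot{\mathbf m}=\mathbf m\times H_{\mathbf m}$. The relative equilibria (RE) are the equilibria of these equations. The symplectic leaf through a point with $\mathbf m\ne0$ is the level set of the Casimir $|\mathbf m|^2$, which is 4-dimensional. The axis of rotation of an RE has the direction of $\omega$. An RE is called *right-angled* if $q=\pi/2$. When $\mu_1=\mu_2$, it is called *isosceles* if the axis of rotation is perpendicular to the radius passing midway between the two bodies, i.e. $\omega\cdot(\mathbf x_1+\mathbf x_2(q))=0$. When $\mu_1\neq\mu_2$, an RE is called *acute* if $q<\pi/2$ and *obtuse* if $q>\pi/2$. At each RE, the Hessian of the restriction of $H$ to the symplectic leaf through that RE has the following signature. **Case $\mu_1=\mu_2$.** 1. Right-angled RE which are not isosceles: $(++--)$. 2. Isosceles RE with $q<\pi/2$: $(+++-)$. 3. Isosceles RE with $q>\pi/2$: $(++--)$. **Case $\mu_1\ne\mu_2$.** Put $\mu=\min(\mu_1,\mu_2)/\max(\mu_1,\mu_2)\in(0,1)$. The equation $$\cos 2\alpha=2\sin^2\alpha\,\sqrt{1-\mu^2\sin^2 2\alpha}$$ has a unique solution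 $\alpha^\dagger$ in $(\pi/2,\pi)$. Put $$q^\dagger=\alpha^\dagger-\frac{\pi}{2}-\frac12\arcsin\bigl(\mu\sin 2\alpha^\dagger\bigr).$$ Then $q^\dagger\in(0,\pi/2)$, and: 1. Acute RE with $0<q<q^\dagger$: $(+++-)$. 2. Acute RE with $q^\dagger<q<\pi/2$: $(++--)$. 3. Obtuse RE: $(++--)$. -/

import Mathlib

open Real Set Filter Topology
open scoped Matrix

noncomputable section

namespace TwoBodySphere

/-! ### The two-body problem on the unit sphere, in a frame moving with the bodies

Every pair of distinct, non-antipodal points of the unit sphere at distance `q` is carried by a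
unique rotation to the pair `pos₁`, `pos₂ q`; this identifies the configuration space with
`(0, π) × SO(3)`. -/

/-- Position of the first body in the moving frame. -/
def pos₁ : Fin 3 → ℝ := ![0, 0, -1]

/-- Position of the second body in the moving frame, at geodesic distance `q` from the first. -/
def pos₂ (q : ℝ) : Fin 3 → ℝ := ![0, sin q, -cos q]

theorem dotProduct_pos (q : ℝ) : pos₁ ⬝ᵥ pos₂ q = cos q := by
  simp [pos₁, pos₂, dotProduct, Fin.sum_univ_three]

/-- Velocity of the first body, in the moving frame, for the body angular velocity `ω`. -/
def vel₁ (ω : Fin 3 → ℝ) : Fin 3 → ℝ := ω ⨯₃ pos₁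

/-- Velocity of the second body, in the moving frame, for the body angular velocity `ω` and the
rate of change `q'` of the distance. -/
def vel₂ (q q' : ℝ) (ω : Fin 3 → ℝ) : Fin 3 → ℝ := ω ⨯₃ pos₂ q + q' • deriv pos₂ q

/-- The kinetic energy of two bodies of masses `μ₁`, `μ₂`. -/
def kineticEnergy (μ₁ μ₂ q q' : ℝ) (ω : Fin 3 → ℝ) : ℝ :=
  1 / 2 * μ₁ * (vel₁ ω ⬝ᵥ vel₁ ω) + 1 / 2 * μ₂ * (vel₂ q q' ω ⬝ᵥ vel₂ q q' ω)

/-- The mass matrix, with respect to the velocities `(q', ω₁, ω₂, ω₃)`. -/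
def massMatrix (μ₁ μ₂ q : ℝ) : Matrix (Fin 4) (Fin 4) ℝ :=
  !![μ₂, μ₂, 0, 0;
     μ₂, μ₁ + μ₂, 0, 0;
     0, 0, μ₁ + μ₂ * cos q ^ 2, μ₂ * sin q * cos q;
     0, 0, μ₂ * sin q * cos q, μ₂ * sin q ^ 2]

/-- The kinetic energy is the quadratic form with matrix `massMatrix`. -/
theorem kineticEnergy_eq (μ₁ μ₂ q q' : ℝ) (ω : Fin 3 → ℝ) :
    kineticEnergy μ₁ μ₂ q q' ω =
      1 / 2 * (![q', ω 0, ω 1, ω 2] ⬝ᵥ (massMatrix μ₁ μ₂ q *ᵥ ![q', ω 0, ω 1, ω 2])) := by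
  have hd : deriv pos₂ q = ![0, cos q, sin q] := by
    refine HasDerivAt.deriv (hasDerivAt_pi.2 fun i => ?_)
    fin_cases i
    · simpa [pos₂] using hasDerivAt_const q (0 : ℝ)
    · simpa [pos₂] using hasDerivAt_sin q
    · simpa [pos₂, Pi.neg_def] using (hasDerivAt_cos q).neg
  simp only [kineticEnergy, vel₁, vel₂, hd, pos₁, pos₂, massMatrix, cross_apply, dotProduct,
    Matrix.mulVec, Fin.sum_univ_three, Fin.sum_univ_four, Pi.add_apply, Pi.smul_apply, smul_eq_mul]
  simp
  linear_combination (1 / 2 * μ₂ * (q' + ω 0) ^ 2) * sin_sq_add_cos_sq q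

/-! ### The reduced system -/

/-- Coordinates `(q, p, m)`: distance, its conjugate momentum, body angular momentum. -/
abbrev Phase := ℝ × ℝ × (Fin 3 → ℝ)

/-- The Poisson reduced space `T^*(0, π) × so(3)^*`. -/
def reducedSpace : Set Phase := {z | z.1 ∈ Ioo 0 π}

/-- The momenta `(p, m₁, m₂, m₃)` as a vector. -/
def momenta (z : Phase) : Fin 4 → ℝ := ![z.2.1, z.2.2 0, z.2.2 1, z.2.2 2]

/-- The velocities `(q', ω₁, ω₂, ω₃)`, obtained by inverting the Legendre transform. -/
def velocities (μ₁ μ₂ : ℝ) (z : Phase) : Fin 4 → ℝ :=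
  (massMatrix μ₁ μ₂ z.1)⁻¹ *ᵥ momenta z

/-- The body angular velocity; its direction is the axis of rotation, in the moving frame. -/
def angularVelocity (μ₁ μ₂ : ℝ) (z : Phase) : Fin 3 → ℝ :=
  ![velocities μ₁ μ₂ z 1, velocities μ₁ μ₂ z 2, velocities μ₁ μ₂ z 3]

/-- The reduced Hamiltonian for the interaction potential `V`. -/
def reducedHamiltonian (μ₁ μ₂ : ℝ) (V : ℝ → ℝ) (z : Phase) : ℝ :=
  1 / 2 * (momenta z ⬝ᵥ ((massMatrix μ₁ μ₂ z.1)⁻¹ *ᵥ momenta z)) + V z.1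

/-- The Poisson tensor at `z`, as a linear map from covectors to vectors. It sends the differential
of `H` to its Hamiltonian vector field `(H_p, -H_q, m × H_m)`, and corresponds to the brackets
`{q, p} = 1`, `{m₁, m₂} = -m₃`, `{m₂, m₃} = -m₁`, `{m₃, m₁} = -m₂`. -/
def poissonMap (z : Phase) : (Phase →L[ℝ] ℝ) →ₗ[ℝ] Phase where
  toFun a := (a (0, 1, 0), -a (1, 0, 0), z.2.2 ⨯₃ fun i => a (0, 0, Pi.single i 1))
  map_add' a b := by
    have h : (fun i : Fin 3 => (a + b) (0, 0, Pi.single i 1)) =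
        (fun i => a (0, 0, Pi.single i 1)) + fun i => b (0, 0, Pi.single i 1) := rfl
    rw [h, map_add]
    simp [add_comm]
  map_smul' c a := by
    have h : (fun i : Fin 3 => (c • a) (0, 0, Pi.single i 1)) =
        c • fun i => a (0, 0, Pi.single i 1) := rfl
    rw [h, map_smul]
    simp

/-- The Hamiltonian vector field of a function on the reduced space. -/
def hamiltonianVectorField (H : Phase → ℝ) (z : Phase) : Phase := poissonMap z (fderiv ℝ H z)

/-- Relative equilibria are the equilibria of the reduced system. -/
def IsRelativeEquilibrium (μ₁ μ₂ : ℝ) (V : ℝ → ℝ) (z : Phase) : Prop :=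
  z ∈ reducedSpace ∧ hamiltonianVectorField (reducedHamiltonian μ₁ μ₂ V) z = 0

/-- The axis of rotation is perpendicular to the radius that passes midway between the bodies. -/
def IsIsosceles (μ₁ μ₂ : ℝ) (z : Phase) : Prop :=
  angularVelocity μ₁ μ₂ z ⬝ᵥ (pos₁ + pos₂ z.1) = 0

/-! ### Symplectic leaves and the Hessian on a leaf -/

/-- The Casimir function `|m|²`. -/
def casimir (z : Phase) : ℝ := z.2.2 ⬝ᵥ z.2.2

/-- The symplectic leaf through `z`: the level set of the Casimir, which is connected. -/
def symplecticLeaf (z : Phase) : Set Phase := {w | w ∈ reducedSpace ∧ casimir w = casimir z}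

/-- The tangent space at `z` to the symplectic leaf through `z`: the span of the Hamiltonian vector
fields. It has dimension 4 when `m ≠ 0`. -/
def leafTangent (z : Phase) : Submodule ℝ Phase := LinearMap.range (poissonMap z)

/-- `Q` is the Hessian at `z` of the restriction of `f` to the symplectic leaf through `z`:
for each tangent vector `v` and each curve in the leaf with velocity `v` at `z`, the second
derivative of `f` along the curve is `Q v`. (Such a `Q` can exist only at a critical point of the
restriction.) -/
def IsLeafHessian (f : Phase → ℝ) (z : Phase) (Q : QuadraticForm ℝ (leafTangent z)) : Prop :=
  ∀ (v : leafTangent z) (γ : ℝ → Phase), ContDiffAt ℝ 2 γ 0 → γ 0 = z →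
    (∀ᶠ t in 𝓝 0, γ t ∈ symplecticLeaf z) → deriv γ 0 = v →
      iteratedDeriv 2 (f ∘ γ) 0 = Q v

/-- The Hessian at `z` of the restriction of `f` to the symplectic leaf through `z` has signature
with `a` plus signs and `b` minus signs. -/
def HasLeafSignature (f : Phase → ℝ) (z : Phase) (a b : ℕ) : Prop :=
  ∃ Q : QuadraticForm ℝ (leafTangent z),
    IsLeafHessian f z Q ∧ sigPos Q = a ∧ sigNeg Q = b

/-! ### The critical angle -/

/-- The equation in `(π/2, π)` for the angle `α` that determines the critical separation, for the
mass ratio `μ`. -/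
def IsCriticalAxisAngle (μ α : ℝ) : Prop :=
  α ∈ Ioo (π / 2) π ∧ cos (2 * α) = 2 * sin α ^ 2 * √(1 - μ ^ 2 * sin (2 * α) ^ 2)

/-- The critical separation determined by `α`. -/
def criticalSeparation (μ α : ℝ) : ℝ := α - π / 2 - 1 / 2 * arcsin (μ * sin (2 * α))

end TwoBodySphere

end

namespace TwoBodySphere

/-! At a relative equilibrium `p = m₁ = 0` and `ω = l m`, so the axis lies in the plane of the
bodies. Repulsion forces the axis to pass between them (`IsRelativeEquilibrium.exists_tangents`).
With `a`, `b` the tangents of their angles to the axis, the balance law `μ₁ sin (2 arctan a) = μ₂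
sin (2 arctan b)` and `q = π - arctan a - arctan b` make everything rational in `a`, `b` and a scale
`κ`.

The Hessian on the leaf is that of `H - (l/2)|m|²` on the tangent space. It splits into a `(p, m₁)`
block, always of signature `(+-)`, and a `(q, m₂)` block with a positive diagonal entry and
determinant of the sign of `D = 3a²b² - 1 - a² - b²` (`shape_det_eq`). Hence `D > 0` gives `(+++-)`
and `D < 0` gives `(++--)`.

It remains to find the sign of `D`. If `q > π/2` then `ab < 1` and `D < 0`. For equal masses either
`a = b` or `ab = 1`, and `D` factors. For unequal masses with `q < π/2`, put `α = π - arctan a`,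
where `a` belongs to the lighter body. Then `q` is an increasing function of `α`, and `D` is a
negative multiple of the defect in the critical equation (`criticalDefect_eq_of_tangents`), which
changes sign exactly once (`exists_critical`). -/

/-! ### The Hamiltonian in the variable `cot q` and the equilibrium equations -/

theorem hasDerivAt_cot {x : ℝ} (hx : sin x ≠ 0) : HasDerivAt cot (-(1 + cot x ^ 2)) x := by
  have h : cot = fun x => cos x / sin x := funext cot_eq_cos_div_sin
  rw [cot_eq_cos_div_sin, h]
  refine ((hasDerivAt_cos x).div (hasDerivAt_sin x) hx).congr_deriv ?_
  field_simp
  ring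

theorem contDiffAt_cot {x : ℝ} (hx : sin x ≠ 0) {n : WithTop ℕ∞} : ContDiffAt ℝ n cot x := by
  have h : cot = fun x => cos x / sin x := funext cot_eq_cos_div_sin
  rw [h]
  exact contDiff_cos.contDiffAt.div contDiff_sin.contDiffAt hx

/-- The inverse of the mass matrix, in terms of `k = cot q`. -/
theorem massMatrix_inv {μ₁ μ₂ q : ℝ} (h₁ : μ₁ ≠ 0) (h₂ : μ₂ ≠ 0) (hq : sin q ≠ 0) :
    (massMatrix μ₁ μ₂ q)⁻¹ =
      !![1 / μ₁ + 1 / μ₂, -1 / μ₁, 0, 0;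
         -1 / μ₁, 1 / μ₁, 0, 0;
         0, 0, 1 / μ₁, -cot q / μ₁;
         0, 0, -cot q / μ₁, cot q ^ 2 / μ₁ + (1 + cot q ^ 2) / μ₂] := by
  refine Matrix.inv_eq_right_inv ?_
  have hsc : cos q ^ 2 = 1 - sin q ^ 2 := by linarith [sin_sq_add_cos_sq q]
  rw [cot_eq_cos_div_sin]
  ext i j
  fin_cases i <;> fin_cases j <;>
    simp [massMatrix, Matrix.mul_apply, Fin.sum_univ_four] <;> field_simp <;>
    first | ring1 | (ring_nf; done) | skip
  all_goals grind

/-- The reduced Hamiltonian in terms of `k = cot q` and the momenta. -/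
noncomputable def energy (μ₁ μ₂ k p x y z : ℝ) : ℝ :=
  1 / 2 * (p * p / μ₂ + (p - x) * (p - x) / μ₁) +
    1 / 2 * ((y - k * z) * (y - k * z) / μ₁ + z * z * (1 + k * k) / μ₂) + k

theorem velocities_eq {μ₁ μ₂ : ℝ} (h₁ : μ₁ ≠ 0) (h₂ : μ₂ ≠ 0) {z : Phase} (hz : sin z.1 ≠ 0) :
    velocities μ₁ μ₂ z =
      ![z.2.1 / μ₂ + (z.2.1 - z.2.2 0) / μ₁, (z.2.2 0 - z.2.1) / μ₁,
        (z.2.2 1 - cot z.1 * z.2.2 2) / μ₁,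
        -cot z.1 * (z.2.2 1 - cot z.1 * z.2.2 2) / μ₁ + z.2.2 2 * (1 + cot z.1 ^ 2) / μ₂] := by
  ext i
  rw [velocities, massMatrix_inv h₁ h₂ hz]
  fin_cases i <;> simp [momenta, Matrix.mulVec, dotProduct, Fin.sum_univ_four] <;> ring

theorem reducedHamiltonian_eq {μ₁ μ₂ : ℝ} (h₁ : μ₁ ≠ 0) (h₂ : μ₂ ≠ 0) {z : Phase}
    (hz : sin z.1 ≠ 0) :
    reducedHamiltonian μ₁ μ₂ cot z =
      energy μ₁ μ₂ (cot z.1) z.2.1 (z.2.2 0) (z.2.2 1) (z.2.2 2) := by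
  rw [reducedHamiltonian, ← velocities, velocities_eq h₁ h₂ hz]
  simp [momenta, dotProduct, Fin.sum_univ_four, energy]
  ring

theorem sin_ne_zero_of_mem_reducedSpace {z : Phase} (hz : z ∈ reducedSpace) : sin z.1 ≠ 0 :=
  (sin_pos_of_mem_Ioo hz).ne'

theorem eventually_reducedHamiltonian_eq {μ₁ μ₂ : ℝ} (h₁ : μ₁ ≠ 0) (h₂ : μ₂ ≠ 0) {z : Phase}
    (hz : z ∈ reducedSpace) :
    reducedHamiltonian μ₁ μ₂ cot =ᶠ[𝓝 z] fun w =>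
      energy μ₁ μ₂ (cot w.1) w.2.1 (w.2.2 0) (w.2.2 1) (w.2.2 2) := by
  have : reducedSpace ∈ 𝓝 z := (isOpen_Ioo.preimage continuous_fst).mem_nhds hz
  filter_upwards [this] with w hw
  exact reducedHamiltonian_eq h₁ h₂ (sin_ne_zero_of_mem_reducedSpace hw)

theorem hasDerivAt_energy {μ₁ μ₂ : ℝ} {k p x y z : ℝ → ℝ} {t k' p' x' y' z' : ℝ}
    (hk : HasDerivAt k k' t) (hp : HasDerivAt p p' t) (hx : HasDerivAt x x' t)
    (hy : HasDerivAt y y' t) (hz : HasDerivAt z z' t) :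
    HasDerivAt (fun s => energy μ₁ μ₂ (k s) (p s) (x s) (y s) (z s))
      ((p t / μ₂ + (p t - x t) / μ₁) * p' + (x t - p t) / μ₁ * x' +
        (y t - k t * z t) / μ₁ * y' +
        (-k t * (y t - k t * z t) / μ₁ + z t * (1 + k t ^ 2) / μ₂) * z' +
        (-z t * (y t - k t * z t) / μ₁ + z t ^ 2 * k t / μ₂ + 1) * k') t := by
  unfold energy
  refine (((((hp.mul hp).div_const μ₂).add (((hp.sub hx).mul (hp.sub hx)).div_const μ₁)).const_mul
    (1 / 2)).add (((((hy.sub (hk.mul hz)).mul (hy.sub (hk.mul hz))).div_const μ₁).add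
      (((hz.mul hz).mul ((hk.mul hk).const_add 1)).div_const μ₂)).const_mul (1 / 2)) |>.add hk).congr_deriv ?_
  simp
  ring

/-- The differential is read off along the lines `z + t v`, which reduces it to the one-variable
`hasDerivAt_energy`. The factor `1 + cot²` is minus the derivative of `cot`. -/
theorem fderiv_reducedHamiltonian {μ₁ μ₂ : ℝ} (h₁ : μ₁ ≠ 0) (h₂ : μ₂ ≠ 0) {z : Phase}
    (hz : z ∈ reducedSpace) (v : Phase) :
    fderiv ℝ (reducedHamiltonian μ₁ μ₂ cot) z v =
      velocities μ₁ μ₂ z 0 * v.2.1 + angularVelocity μ₁ μ₂ z ⬝ᵥ v.2.2 -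
        (-z.2.2 2 * (z.2.2 1 - cot z.1 * z.2.2 2) / μ₁ + z.2.2 2 ^ 2 * cot z.1 / μ₂ + 1) *
          (1 + cot z.1 ^ 2) * v.1 := by
  have hs := sin_ne_zero_of_mem_reducedSpace hz
  rw [(eventually_reducedHamiltonian_eq h₁ h₂ hz).fderiv_eq]
  have hd : DifferentiableAt ℝ (fun w : Phase =>
      energy μ₁ μ₂ (cot w.1) w.2.1 (w.2.2 0) (w.2.2 1) (w.2.2 2)) z := by
    have hc : DifferentiableAt ℝ (fun w : Phase => cot w.1) z :=
      (hasDerivAt_cot hs).differentiableAt.comp z differentiableAt_fst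
    unfold energy
    fun_prop
  have hl : HasDerivAt (fun t : ℝ => z + t • v) v 0 := by
    simpa using ((hasDerivAt_id (0 : ℝ)).smul_const v).const_add z
  have h0 : z + (0 : ℝ) • v = z := by simp
  have hA := (h0.symm ▸ hd.hasFDerivAt : HasFDerivAt _ _ (z + (0 : ℝ) • v)).comp_hasDerivAt 0 hl
  have hq : HasDerivAt (fun t : ℝ => z.1 + t * v.1) v.1 0 := by
    simpa using ((hasDerivAt_id (0 : ℝ)).mul_const v.1).const_add z.1
  have hp : HasDerivAt (fun t : ℝ => z.2.1 + t * v.2.1) v.2.1 0 := by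
    simpa using ((hasDerivAt_id (0 : ℝ)).mul_const v.2.1).const_add z.2.1
  have hm (i : Fin 3) : HasDerivAt (fun t : ℝ => z.2.2 i + t * v.2.2 i) (v.2.2 i) 0 := by
    simpa using ((hasDerivAt_id (0 : ℝ)).mul_const (v.2.2 i)).const_add (z.2.2 i)
  have hk : HasDerivAt (fun t : ℝ => cot (z.1 + t * v.1)) (-(1 + cot z.1 ^ 2) * v.1) 0 := by
    have := hasDerivAt_cot (x := z.1 + 0 * v.1) (by simpa using hs)
    simpa [Function.comp_def] using this.comp (0 : ℝ) hq
  have hB := hasDerivAt_energy (μ₁ := μ₁) (μ₂ := μ₂) hk hp (hm 0) (hm 1) (hm 2)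
  have := hA.unique hB
  rw [h0] at this
  rw [this, angularVelocity, velocities_eq h₁ h₂ hs]
  simp [dotProduct, Fin.sum_univ_three]
  ring

/-- The conditions on the coordinates that characterise relative equilibria. -/
theorem IsRelativeEquilibrium.equations {μ₁ μ₂ : ℝ} (h₁ : μ₁ ≠ 0) (h₂ : μ₂ ≠ 0) {z : Phase}
    (hz : IsRelativeEquilibrium μ₁ μ₂ cot z) :
    velocities μ₁ μ₂ z 0 = 0 ∧ z.2.2 ⨯₃ angularVelocity μ₁ μ₂ z = 0 ∧
      -z.2.2 2 * (z.2.2 1 - cot z.1 * z.2.2 2) / μ₁ + z.2.2 2 ^ 2 * cot z.1 / μ₂ + 1 = 0 := by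
  obtain ⟨hr, h⟩ := hz
  simp only [hamiltonianVectorField, poissonMap, LinearMap.coe_mk, AddHom.coe_mk,
    fderiv_reducedHamiltonian h₁ h₂ hr, Prod.mk_eq_zero] at h
  obtain ⟨ha, hb, hc⟩ := h
  refine ⟨by simpa using ha, by simpa using hc, ?_⟩
  have : (1 + cot z.1 ^ 2) ≠ 0 := by positivity
  simpa [this] using hb

/-- With `m₃ = 0` nothing balances the repulsion. If `m₁ ≠ 0`, then `q' = 0` gives `ω₁ = m₁ / (μ₁ +
μ₂)`, and parallelism extends this factor to all of `ω`; the other two components then force `m₃ /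
μ₂ = m₃ / (μ₁ + μ₂)`, which is absurd. -/
theorem IsRelativeEquilibrium.momenta_eq_zero {μ₁ μ₂ : ℝ} (h₁ : 0 < μ₁) (h₂ : 0 < μ₂) {z : Phase}
    (hz : IsRelativeEquilibrium μ₁ μ₂ cot z) :
    z.2.1 = 0 ∧ z.2.2 0 = 0 ∧ z.2.2 2 ≠ 0 := by
  obtain ⟨e0, ec, ek⟩ := hz.equations h₁.ne' h₂.ne'
  have hs := sin_ne_zero_of_mem_reducedSpace hz.1
  rw [angularVelocity, velocities_eq h₁.ne' h₂.ne' hs, cross_apply] at ec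
  rw [velocities_eq h₁.ne' h₂.ne' hs] at e0
  have e1 := congrFun ec 0
  have e2 := congrFun ec 1
  have e3 := congrFun ec 2
  clear ec
  simp only [Matrix.cons_val] at e0 e1 e2 e3
  generalize z.2.2 0 = x at *
  generalize z.2.2 1 = y at *
  generalize z.2.2 2 = w at *
  generalize z.2.1 = p at *
  generalize cot z.1 = k at *
  have hw : w ≠ 0 := by rintro rfl; simp at ek
  have hp : p * (μ₁ + μ₂) = x * μ₂ := by field_simp at e0; linarith
  have hx : x = 0 := by
    by_contra hx
    have hω : (x - p) / μ₁ = x / (μ₁ + μ₂) := by field_simp; linarith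
    rw [hω] at e2 e3
    simp only [Pi.zero_apply] at e2 e3
    have h3 : (y - k * w) / μ₁ = y / (μ₁ + μ₂) := by
      apply mul_left_cancel₀ hx; linear_combination e3
    have h2 : -k * (y - k * w) / μ₁ + w * (1 + k ^ 2) / μ₂ = w / (μ₁ + μ₂) := by
      apply mul_left_cancel₀ hx; linear_combination -e2
    have h4 : μ₂ * y = (μ₁ + μ₂) * k * w := by field_simp at h3; linear_combination h3
    have h5 : w / μ₂ = w / (μ₁ + μ₂) := by
      rw [← h2, mul_div_assoc, h3]
      field_simp
      linear_combination k * h4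
    field_simp at h5
    exact h₁.ne' (by simpa using h5)
  refine ⟨?_, hx, hw⟩
  rw [hx, zero_mul] at hp
  simpa [(add_pos h₁ h₂).ne'] using hp

/-! ### The angles between the axis and the bodies -/

/-- Here `τ = m₂/m₃ - cot q`. The equation `he` says that `m` and `ω` are parallel, and `hD` is the
force balance for a repelling potential; it selects the branch on which the axis separates the
bodies. -/
theorem pos_of_quadratic {μ₁ μ₂ k τ : ℝ} (h₁ : 0 < μ₁) (h₂ : 0 < μ₂)
    (hD : μ₁ * k < μ₂ * τ)
    (he : μ₁ * (1 + k ^ 2) * (τ + k) = μ₂ * τ * (k * τ + 1 + k ^ 2)) :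
    0 < τ ∧ 0 < τ + k := by
  rcases le_or_gt 0 k with hk | hk
  · have hτ : 0 < τ := pos_of_mul_pos_right ((mul_nonneg h₁.le hk).trans_lt hD) h₂.le
    exact ⟨hτ, by linarith⟩
  · have hτ : 0 < τ := by
      by_contra! h
      -- Adding `hA` and `hB` and substituting `he` leaves `0 < μ₁ * τ`.
      have hA : (k * τ) * (μ₁ * k) ≤ (k * τ) * (μ₂ * τ) :=
        mul_le_mul_of_nonneg_left hD.le (mul_nonneg_of_nonpos_of_nonpos hk.le h)
      have hB : (1 + k ^ 2) * (μ₁ * k) < (1 + k ^ 2) * (μ₂ * τ) :=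
        mul_lt_mul_of_pos_left hD (by positivity)
      nlinarith [mul_nonneg h₁.le (neg_nonneg.2 h)]
    refine ⟨hτ, ?_⟩
    by_contra! h
    have h3 : 0 < k * τ + 1 + k ^ 2 := by nlinarith
    have h4 : 0 < μ₂ * τ * (k * τ + 1 + k ^ 2) := by positivity
    have h5 : 0 ≤ μ₁ * (1 + k ^ 2) * -(τ + k) := mul_nonneg (by positivity) (by linarith)
    linarith

/-- At a relative equilibrium the axis of rotation separates the bodies; `a` and `b` are the
tangents of the angles that they make with the axis. -/
theorem IsRelativeEquilibrium.exists_tangents {μ₁ μ₂ : ℝ} (h₁ : 0 < μ₁) (h₂ : 0 < μ₂) {z : Phase}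
    (hz : IsRelativeEquilibrium μ₁ μ₂ cot z) :
    ∃ a b κ : ℝ, 0 < a ∧ 0 < b ∧ 0 < κ ∧ μ₁ = κ * (1 + a ^ 2) / a ∧ μ₂ = κ * (1 + b ^ 2) / b ∧
      cot z.1 = (a * b - 1) / (a + b) ∧ z.2.2 1 = a * z.2.2 2 := by
  obtain ⟨hp, hx, hw⟩ := hz.momenta_eq_zero h₁ h₂
  obtain ⟨-, ec, ek⟩ := hz.equations h₁.ne' h₂.ne'
  have hs := sin_ne_zero_of_mem_reducedSpace hz.1
  rw [angularVelocity, velocities_eq h₁.ne' h₂.ne' hs, cross_apply] at ec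
  have e1 := congrFun ec 0
  clear ec
  simp only [Matrix.cons_val, Pi.zero_apply] at e1
  generalize z.2.2 1 = y at *
  generalize z.2.2 2 = w at *
  generalize cot z.1 = k at *
  obtain ⟨τ, rfl⟩ : ∃ τ, y = (τ + k) * w := ⟨y / w - k, by field_simp; ring⟩
  have hD : μ₁ * k < μ₂ * τ := by
    have h : 0 < w ^ 2 * (μ₂ * τ - μ₁ * k) := by
      have : w ^ 2 * (μ₂ * τ - μ₁ * k) = μ₁ * μ₂ := by field_simp at ek; linear_combination -ek
      rw [this]; positivity
    linarith [pos_of_mul_pos_right h (sq_nonneg w)]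
  have he : μ₁ * (1 + k ^ 2) * (τ + k) = μ₂ * τ * (k * τ + 1 + k ^ 2) := by
    apply mul_left_cancel₀ (pow_ne_zero 2 hw)
    field_simp at e1
    linear_combination e1
  obtain ⟨hτ, ha⟩ := pos_of_quadratic h₁ h₂ hD he
  obtain ⟨a, rfl⟩ : ∃ a, τ = a - k := ⟨τ + k, by ring⟩
  have hak : a - k + k = a := by ring
  rw [hak] at ha he
  rw [hak]
  have h1 : 0 < 1 + k * a := by
    have : 0 < μ₂ * (a - k) * (1 + k * a) := by
      have : μ₂ * (a - k) * (1 + k * a) = μ₁ * (1 + k ^ 2) * a := by rw [he]; ring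
      rw [this]; positivity
    exact pos_of_mul_pos_right this (by positivity)
  -- This `b` solves `k = (a * b - 1) / (a + b)`, the addition formula for the cotangent.
  have hb : 0 < (1 + k * a) / (a - k) := by positivity
  have hb' : (1 + k * a) / (a - k) * (a - k) = 1 + k * a := div_mul_cancel₀ _ hτ.ne'
  generalize (1 + k * a) / (a - k) = b at *
  have hbk : k = (a * b - 1) / (a + b) := by
    rw [eq_div_iff (by positivity)]; linear_combination -hb'
  refine ⟨a, b, μ₁ * a / (1 + a ^ 2), ha, hb, by positivity, by field_simp, ?_, hbk, rfl⟩
  field_simp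
  have h7 : (1 + b ^ 2) * (a - k) ^ 2 = (1 + a ^ 2) * (1 + k ^ 2) := by
    linear_combination (b * (a - k) + (1 + k * a)) * hb'
  apply mul_left_cancel₀ (pow_ne_zero 2 hτ.ne')
  linear_combination (-(1 + a ^ 2)) * he - μ₁ * a * h7 + μ₂ * (a - k) * (1 + a ^ 2) * hb'

/-! ### Second-order jets of real functions at the origin -/

/-- `u` is twice continuously differentiable at `0`, with value `a` and first two derivatives `b`
and `c`. -/
structure HasJet (u : ℝ → ℝ) (a b c : ℝ) : Prop where
  contDiffAt : ContDiffAt ℝ 2 u 0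
  value : u 0 = a
  first : deriv u 0 = b
  second : iteratedDeriv 2 u 0 = c

theorem hasJet_of_contDiffAt {u : ℝ → ℝ} (hu : ContDiffAt ℝ 2 u 0) :
    HasJet u (u 0) (deriv u 0) (iteratedDeriv 2 u 0) :=
  ⟨hu, rfl, rfl, rfl⟩

theorem HasJet.const (c : ℝ) : HasJet (fun _ => c) c 0 0 :=
  ⟨contDiffAt_const, rfl, by simp, by simp [iteratedDeriv_const]⟩

section

variable {u v : ℝ → ℝ} {a b c a' b' c' : ℝ}

theorem HasJet.differentiableAt (hu : HasJet u a b c) : DifferentiableAt ℝ u 0 :=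
  hu.contDiffAt.differentiableAt (by norm_num)

theorem HasJet.add (hu : HasJet u a b c) (hv : HasJet v a' b' c') :
    HasJet (fun t => u t + v t) (a + a') (b + b') (c + c') where
  contDiffAt := hu.contDiffAt.add hv.contDiffAt
  value := by rw [hu.value, hv.value]
  first := by rw [deriv_fun_add hu.differentiableAt hv.differentiableAt, hu.first, hv.first]
  second := by rw [iteratedDeriv_fun_add hu.contDiffAt hv.contDiffAt, hu.second, hv.second]

theorem HasJet.mul (hu : HasJet u a b c) (hv : HasJet v a' b' c') :
    HasJet (fun t => u t * v t) (a * a') (b * a' + a * b') (c * a' + 2 * b * b' + a * c') where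
  contDiffAt := hu.contDiffAt.mul hv.contDiffAt
  value := by rw [hu.value, hv.value]
  first := by
    rw [deriv_fun_mul hu.differentiableAt hv.differentiableAt, hu.first, hv.first, hu.value,
      hv.value]
  second := by
    have h : (fun t => u t * v t) = u * v := rfl
    rw [h, iteratedDeriv_mul hu.contDiffAt hv.contDiffAt]
    simp [Finset.sum_range_succ, hu.value, hv.value, hu.first, hv.first, hu.second, hv.second,
      iteratedDeriv_one]
    ring

theorem HasJet.sub (hu : HasJet u a b c) (hv : HasJet v a' b' c') :
    HasJet (fun t => u t - v t) (a - a') (b - b') (c - c') := by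
  have := hu.add ((HasJet.const (-1)).mul hv)
  simpa [sub_eq_add_neg] using this

theorem HasJet.div_const (hu : HasJet u a b c) (r : ℝ) :
    HasJet (fun t => u t / r) (a / r) (b / r) (c / r) := by
  have := hu.mul (HasJet.const r⁻¹)
  simpa [div_eq_mul_inv] using this

end

theorem HasJet.energy {μ₁ μ₂ : ℝ} {k p x y z : ℝ → ℝ}
    {k₀ k₁ k₂ p₀ p₁ p₂ x₀ x₁ x₂ y₀ y₁ y₂ z₀ z₁ z₂ : ℝ}
    (hk : HasJet k k₀ k₁ k₂) (hp : HasJet p p₀ p₁ p₂) (hx : HasJet x x₀ x₁ x₂)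
    (hy : HasJet y y₀ y₁ y₂) (hz : HasJet z z₀ z₁ z₂) :
    iteratedDeriv 2 (fun t => TwoBodySphere.energy μ₁ μ₂ (k t) (p t) (x t) (y t) (z t)) 0 =
      p₁ ^ 2 / μ₂ + (p₁ - x₁) ^ 2 / μ₁ +
        ((y₁ - k₁ * z₀ - k₀ * z₁) ^ 2 - 2 * (y₀ - k₀ * z₀) * k₁ * z₁) / μ₁ +
        (z₁ ^ 2 * (1 + k₀ ^ 2) + 4 * z₀ * z₁ * k₀ * k₁ + z₀ ^ 2 * k₁ ^ 2) / μ₂ +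
        ((p₀ / μ₂ + (p₀ - x₀) / μ₁) * p₂ + (x₀ - p₀) / μ₁ * x₂ + (y₀ - k₀ * z₀) / μ₁ * y₂ +
          (-k₀ * (y₀ - k₀ * z₀) / μ₁ + z₀ * (1 + k₀ ^ 2) / μ₂) * z₂ +
          (-z₀ * (y₀ - k₀ * z₀) / μ₁ + z₀ ^ 2 * k₀ / μ₂ + 1) * k₂) := by
  have hX := hy.sub (hk.mul hz)
  have := (((HasJet.const (1 / 2)).mul
    (((hp.mul hp).div_const μ₂).add (((hp.sub hx).mul (hp.sub hx)).div_const μ₁))).add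
    ((HasJet.const (1 / 2)).mul (((hX.mul hX).div_const μ₁).add
      (((hz.mul hz).mul ((HasJet.const 1).add (hk.mul hk))).div_const μ₂)))).add hk
  refine this.second.trans ?_
  ring

/-- The second derivative of the Hamiltonian along a curve in the leaf of a relative
equilibrium. -/
theorem iteratedDeriv_reducedHamiltonian_comp {μ₁ μ₂ : ℝ} (h₁ : μ₁ ≠ 0) (h₂ : μ₂ ≠ 0) {z : Phase}
    (hz : IsRelativeEquilibrium μ₁ μ₂ cot z) (hp : z.2.1 = 0) (hx : z.2.2 0 = 0) {l : ℝ}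
    (hl₁ : (z.2.2 1 - cot z.1 * z.2.2 2) / μ₁ = l * z.2.2 1)
    (hl₂ : -cot z.1 * (z.2.2 1 - cot z.1 * z.2.2 2) / μ₁ + z.2.2 2 * (1 + cot z.1 ^ 2) / μ₂ =
      l * z.2.2 2)
    {v : Phase} {γ : ℝ → Phase} (hγ : ContDiffAt ℝ 2 γ 0) (h0 : γ 0 = z)
    (hleaf : ∀ᶠ t in 𝓝 0, γ t ∈ symplecticLeaf z) (hv : deriv γ 0 = v) :
    iteratedDeriv 2 (reducedHamiltonian μ₁ μ₂ cot ∘ γ) 0 =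
      v.2.1 ^ 2 / μ₂ + (v.2.1 - v.2.2 0) ^ 2 / μ₁ +
        ((v.2.2 1 + (1 + cot z.1 ^ 2) * v.1 * z.2.2 2 - cot z.1 * v.2.2 2) ^ 2 +
          2 * (z.2.2 1 - cot z.1 * z.2.2 2) * ((1 + cot z.1 ^ 2) * v.1) * v.2.2 2) / μ₁ +
        (v.2.2 2 ^ 2 * (1 + cot z.1 ^ 2) -
          4 * z.2.2 2 * v.2.2 2 * cot z.1 * ((1 + cot z.1 ^ 2) * v.1) +
          z.2.2 2 ^ 2 * ((1 + cot z.1 ^ 2) * v.1) ^ 2) / μ₂ -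
        l * (v.2.2 0 ^ 2 + v.2.2 1 ^ 2 + v.2.2 2 ^ 2) := by
  subst hv h0
  have hs := sin_ne_zero_of_mem_reducedSpace hz.1
  have hd : HasDerivAt γ (deriv γ 0) 0 := (hγ.differentiableAt (by norm_num)).hasDerivAt
  have hdq : HasDerivAt (fun t => (γ t).1) (deriv γ 0).1 0 := by
    simpa using (HasFDerivAt.fst hd.hasFDerivAt).hasDerivAt
  have hdp : HasDerivAt (fun t => (γ t).2.1) (deriv γ 0).2.1 0 := by
    simpa using (HasFDerivAt.fst (HasFDerivAt.snd hd.hasFDerivAt)).hasDerivAt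
  have hdm : HasDerivAt (fun t => (γ t).2.2) (deriv γ 0).2.2 0 := by
    simpa using (HasFDerivAt.snd (HasFDerivAt.snd hd.hasFDerivAt)).hasDerivAt
  have cm (i : Fin 3) : ContDiffAt ℝ 2 (fun t => (γ t).2.2 i) 0 := contDiffAt_pi.1 hγ.snd.snd i
  have dm (i : Fin 3) : deriv (fun t => (γ t).2.2 i) 0 = (deriv γ 0).2.2 i :=
    (hasDerivAt_pi.1 hdm i).deriv
  have dp : deriv (fun t => (γ t).2.1) 0 = (deriv γ 0).2.1 := hdp.deriv
  have ck : ContDiffAt ℝ 2 (fun t => cot (γ t).1) 0 :=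
    ContDiffAt.comp (g := cot) (f := fun t => (γ t).1) 0 (contDiffAt_cot hs) hγ.fst
  have dk : deriv (fun t => cot (γ t).1) 0 = -(1 + cot (γ 0).1 ^ 2) * (deriv γ 0).1 :=
    (HasDerivAt.comp (h₂ := cot) (h := fun t => (γ t).1) 0 (hasDerivAt_cot hs) hdq).deriv
  have jm (i : Fin 3) := hasJet_of_contDiffAt (cm i)
  -- Constancy of the Casimir gives `m · m'' = -|m'|²`. At the equilibrium the second-order terms of
  -- the curve contribute only `l m · m''`, so they can be eliminated.
  have hcas : iteratedDeriv 2 (fun t => (γ t).2.2 0 * (γ t).2.2 0 + (γ t).2.2 1 * (γ t).2.2 1 +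
      (γ t).2.2 2 * (γ t).2.2 2) 0 = 0 := by
    have : (fun t => (γ t).2.2 0 * (γ t).2.2 0 + (γ t).2.2 1 * (γ t).2.2 1 +
        (γ t).2.2 2 * (γ t).2.2 2) =ᶠ[𝓝 0] fun _ => casimir (γ 0) := by
      filter_upwards [hleaf] with t ht
      rw [← ht.2]
      simp [casimir, dotProduct, Fin.sum_univ_three]
    rw [this.iteratedDeriv_eq]
    simp [iteratedDeriv_const]
  have hcas' := ((((jm 0).mul (jm 0)).add ((jm 1).mul (jm 1))).add ((jm 2).mul (jm 2))).second
  rw [hcas] at hcas'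
  have hH : reducedHamiltonian μ₁ μ₂ cot ∘ γ =ᶠ[𝓝 0] fun t =>
      energy μ₁ μ₂ (cot (γ t).1) (γ t).2.1 ((γ t).2.2 0) ((γ t).2.2 1) ((γ t).2.2 2) := by
    filter_upwards [hleaf] with t ht
    exact reducedHamiltonian_eq h₁ h₂ (sin_ne_zero_of_mem_reducedSpace ht.1)
  rw [hH.iteratedDeriv_eq, HasJet.energy (hasJet_of_contDiffAt ck)
    (hasJet_of_contDiffAt hγ.snd.fst) (jm 0) (jm 1) (jm 2)]
  have ek := (hz.equations h₁ h₂).2.2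
  simp only [dm, dp, dk] at hcas' ⊢
  rw [hl₁, hl₂, ek, hp, hx]
  rw [hx] at hcas'
  linear_combination -(l / 2) * hcas'

/-! ### Signature from a diagonalisation -/

theorem HasLeafSignature.of_equiv {f : Phase → ℝ} {z : Phase} (w : Fin 4 → ℝ)
    (e : leafTangent z ≃ₗ[ℝ] (Fin 4 → ℝ))
    (h : ∀ (v : leafTangent z) (γ : ℝ → Phase), ContDiffAt ℝ 2 γ 0 → γ 0 = z →
      (∀ᶠ t in 𝓝 0, γ t ∈ symplecticLeaf z) → deriv γ 0 = v →
        iteratedDeriv 2 (f ∘ γ) 0 = ∑ i, w i * e v i ^ 2) :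
    HasLeafSignature f z {i | 0 < w i}.ncard {i | w i < 0}.ncard := by
  let Q : QuadraticForm ℝ (leafTangent z) :=
    (QuadraticMap.weightedSumSquares ℝ w).comp e.toLinearMap
  have hQ : QuadraticMap.Equivalent Q (QuadraticMap.weightedSumSquares ℝ w) :=
    ⟨⟨e, fun v => rfl⟩⟩
  refine ⟨Q, fun v γ hγ h0 hl hv => ?_, QuadraticForm.sigPos_of_equiv_weightedSumSquares hQ,
    QuadraticForm.sigNeg_of_equiv_weightedSumSquares hQ⟩
  rw [h v γ hγ h0 hl hv]
  simp [Q, QuadraticMap.weightedSumSquares_apply, sq]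

/-- The range of `m × ·` is the plane orthogonal to `m`. The preimage is made explicit by choosing
the covector with vanishing `m₃` component. -/
theorem mem_leafTangent_iff {z : Phase} (hz : z.2.2 2 ≠ 0) {v : Phase} :
    v ∈ leafTangent z ↔ z.2.2 ⬝ᵥ v.2.2 = 0 := by
  constructor
  · rintro ⟨a, rfl⟩
    simp [poissonMap]
  · intro h
    let P (i : Fin 3) : Phase →L[ℝ] ℝ :=
      (ContinuousLinearMap.proj i).comp
        ((ContinuousLinearMap.snd ℝ ℝ (Fin 3 → ℝ)).comp (ContinuousLinearMap.snd ℝ ℝ _))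
    refine ⟨-v.2.1 • ContinuousLinearMap.fst ℝ ℝ _ +
      v.1 • (ContinuousLinearMap.fst ℝ ℝ (Fin 3 → ℝ)).comp (ContinuousLinearMap.snd ℝ ℝ _) +
      (v.2.2 1 / z.2.2 2) • P 0 - (v.2.2 0 / z.2.2 2) • P 1, ?_⟩
    simp only [dotProduct, Fin.sum_univ_three] at h
    refine Prod.ext ?_ (Prod.ext ?_ ?_)
    · simp [poissonMap, P]
    · simp [poissonMap, P]
    · ext i
      fin_cases i <;> simp [poissonMap, P, cross_apply] <;> field_simp
      linarith

/-- Linear coordinates on the tangent space of the leaf through a point with `m₂ = t m₃`. -/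
theorem exists_leafTangent_equiv {z : Phase} (hz : z.2.2 2 ≠ 0) (hx : z.2.2 0 = 0) {t : ℝ}
    (ht : z.2.2 1 = t * z.2.2 2) (r s : ℝ) :
    ∃ e : leafTangent z ≃ₗ[ℝ] (Fin 4 → ℝ), ∀ v : leafTangent z,
      e v = ![v.1.2.1 - r * v.1.2.2 0, v.1.2.2 0, v.1.1 - s * v.1.2.2 1, v.1.2.2 1] ∧
        v.1.2.2 2 = -t * v.1.2.2 1 := by
  have hmem {v : Phase} : v ∈ leafTangent z ↔ v.2.2 2 = -t * v.2.2 1 := by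
    rw [mem_leafTangent_iff hz, dotProduct, Fin.sum_univ_three, hx, ht]
    constructor
    · intro h
      apply mul_left_cancel₀ hz; linear_combination h
    · intro h
      rw [h]; ring
  refine ⟨
    { toFun := fun v => ![v.1.2.1 - r * v.1.2.2 0, v.1.2.2 0, v.1.1 - s * v.1.2.2 1, v.1.2.2 1]
      invFun := fun c => ⟨(c 2 + s * c 3, c 0 + r * c 1, ![c 1, c 3, -t * c 3]), by simp [hmem]⟩
      map_add' := fun v w => by ext i; fin_cases i <;> simp <;> ring
      map_smul' := fun c v => by ext i; fin_cases i <;> simp <;> ring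
      left_inv := fun v => by
        have h := hmem.1 v.2
        refine Subtype.ext (Prod.ext ?_ (Prod.ext ?_ ?_))
        · simp
        · simp
        · ext i
          fin_cases i <;> simp [h]
      right_inv := fun c => by ext i; fin_cases i <;> simp },
    fun v => ⟨rfl, hmem.1 v.2⟩⟩

/-- The determinant of the Hessian in the directions of the distance and of rotations in the plane
of the bodies, in terms of the tangents `a`, `b` of the angles between the axis and the bodies. -/
theorem shape_det_eq {a b κ y : ℝ} (ha : 0 < a) (hb : 0 < b) (hκ : 0 < κ) {μ₁ μ₂ k l : ℝ}
    (h₁ : μ₁ = κ * (1 + a ^ 2) / a) (h₂ : μ₂ = κ * (1 + b ^ 2) / b)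
    (hk : k = (a * b - 1) / (a + b)) (hl : l = 1 / (κ * (a + b))) :
    y ^ 2 * (1 / μ₁ + 1 / μ₂) *
        ((1 + k * a) ^ 2 / μ₁ + a ^ 2 * (1 + k ^ 2) / μ₂ - l * (1 + a ^ 2)) -
      (-y * (1 + k * a) / μ₁ + (a - k) * y * a / μ₁ - 2 * y * k * a / μ₂) ^ 2 =
    y ^ 2 * (3 * a ^ 2 * b ^ 2 - 1 - a ^ 2 - b ^ 2) / (κ ^ 2 * (1 + b ^ 2) ^ 2) := by
  have h1 : 1 + k * a = b * (1 + a ^ 2) / (a + b) := by rw [hk]; field_simp; ring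
  have h2 : 1 + k ^ 2 = (1 + a ^ 2) * (1 + b ^ 2) / (a + b) ^ 2 := by rw [hk]; field_simp; ring
  have hS : (1 + k * a) ^ 2 / μ₁ + a ^ 2 * (1 + k ^ 2) / μ₂ - l * (1 + a ^ 2) =
      (1 + a ^ 2) * (a * b - 1) / (κ * (a + b)) := by
    rw [h1, h2, h₁, h₂, hl]; field_simp; ring
  have hC : -y * (1 + k * a) / μ₁ + (a - k) * y * a / μ₁ - 2 * y * k * a / μ₂ =
      -(y * a * (b ^ 2 - 1)) / (κ * (1 + b ^ 2)) := by
    rw [h1, h₁, h₂, hk]; field_simp; ring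
  have hW : 1 / μ₁ + 1 / μ₂ = (a + b) * (1 + a * b) / (κ * (1 + a ^ 2) * (1 + b ^ 2)) := by
    rw [h₁, h₂]; field_simp; ring
  rw [hS, hC, hW]
  field_simp
  ring

/-- This is the Schur complement of the `(p, m₁)` block, equal to `1 / (μ₁ + μ₂) - l`. -/
theorem momentum_weight_neg {a b κ : ℝ} (ha : 0 < a) (hb : 0 < b) (hκ : 0 < κ) {μ₁ μ₂ l : ℝ}
    (h₁ : μ₁ = κ * (1 + a ^ 2) / a) (h₂ : μ₂ = κ * (1 + b ^ 2) / b)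
    (hl : l = 1 / (κ * (a + b))) :
    1 / μ₁ - l - 1 / (μ₁ ^ 2 * (1 / μ₁ + 1 / μ₂)) < 0 := by
  have : 1 / μ₁ - l - 1 / (μ₁ ^ 2 * (1 / μ₁ + 1 / μ₂)) =
      -(1 / (κ * (a + b) * (1 + a * b))) := by
    rw [h₁, h₂, hl]; field_simp; ring
  rw [this]
  have : 0 < 1 / (κ * (a + b) * (1 + a * b)) := by positivity
  linarith

theorem ncard_pos_weights {w : Fin 4 → ℝ} (h0 : 0 < w 0) (h1 : w 1 < 0) (h2 : 0 < w 2) :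
    (0 < w 3 → {i | 0 < w i}.ncard = 3 ∧ {i | w i < 0}.ncard = 1) ∧
      (w 3 < 0 → {i | 0 < w i}.ncard = 2 ∧ {i | w i < 0}.ncard = 2) := by
  have key (s : Finset (Fin 4)) (t : Set (Fin 4)) (h : ∀ i, i ∈ t ↔ i ∈ s) : t.ncard = s.card := by
    rw [← Set.ncard_coe_finset]; congr 1; ext i; simp [h]
  refine ⟨fun h3 => ⟨?_, ?_⟩, fun h3 => ⟨?_, ?_⟩⟩
  · exact key {0, 2, 3} _ fun i => by fin_cases i <;> simp [h0, h1.le, h2, h3]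
  · exact key {1} _ fun i => by fin_cases i <;> simp [h0.le, h1, h2.le, h3.le]
  · exact key {0, 2} _ fun i => by fin_cases i <;> simp [h0, h1.le, h2, h3.le]
  · exact key {1, 3} _ fun i => by fin_cases i <;> simp [h0.le, h1, h2.le, h3]

/-- The signature of a relative equilibrium, in terms of the tangents of the angles between the
axis and the bodies. -/
theorem IsRelativeEquilibrium.hasLeafSignature {μ₁ μ₂ : ℝ} {z : Phase} (h₁ : 0 < μ₁) (h₂ : 0 < μ₂)
    (hz : IsRelativeEquilibrium μ₁ μ₂ cot z) {a b κ : ℝ} (ha : 0 < a) (hb : 0 < b) (hκ : 0 < κ)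
    (hμ₁ : μ₁ = κ * (1 + a ^ 2) / a) (hμ₂ : μ₂ = κ * (1 + b ^ 2) / b)
    (hk : cot z.1 = (a * b - 1) / (a + b)) (hm : z.2.2 1 = a * z.2.2 2) :
    (0 < 3 * a ^ 2 * b ^ 2 - 1 - a ^ 2 - b ^ 2 →
      HasLeafSignature (reducedHamiltonian μ₁ μ₂ cot) z 3 1) ∧
    (3 * a ^ 2 * b ^ 2 - 1 - a ^ 2 - b ^ 2 < 0 →
      HasLeafSignature (reducedHamiltonian μ₁ μ₂ cot) z 2 2) := by
  obtain ⟨hp, hx, hy⟩ := hz.momenta_eq_zero h₁ h₂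
  obtain ⟨l, hl⟩ : ∃ l, l = 1 / (κ * (a + b)) := ⟨_, rfl⟩
  have hl₁ : (z.2.2 1 - cot z.1 * z.2.2 2) / μ₁ = l * z.2.2 1 := by
    rw [hm, hk, hμ₁, hl]; field_simp; ring
  have hl₂ : -cot z.1 * (z.2.2 1 - cot z.1 * z.2.2 2) / μ₁ + z.2.2 2 * (1 + cot z.1 ^ 2) / μ₂ =
      l * z.2.2 2 := by
    rw [hm, hk, hμ₁, hμ₂, hl]; field_simp; ring
  have hdet := shape_det_eq (y := z.2.2 2) ha hb hκ hμ₁ hμ₂ hk hl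
  have hneg := momentum_weight_neg ha hb hκ hμ₁ hμ₂ hl
  have hH {v : Phase} {γ : ℝ → Phase} := iteratedDeriv_reducedHamiltonian_comp h₁.ne' h₂.ne' hz hp
    hx hl₁ hl₂ (v := v) (γ := γ)
  obtain ⟨M, hM⟩ : ∃ M, M = 1 / μ₁ + 1 / μ₂ := ⟨_, rfl⟩
  have hM0 : 0 < M := by rw [hM]; positivity
  rw [← hM] at hdet hneg
  rw [hm] at hH
  generalize cot z.1 = k at *
  set y := z.2.2 2 with hydef
  obtain ⟨C, hC⟩ : ∃ C, C = -y * (1 + k * a) / μ₁ + (a - k) * y * a / μ₁ - 2 * y * k * a / μ₂ :=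
    ⟨_, rfl⟩
  obtain ⟨S, hS⟩ : ∃ S, S = (1 + k * a) ^ 2 / μ₁ + a ^ 2 * (1 + k ^ 2) / μ₂ - l * (1 + a ^ 2) :=
    ⟨_, rfl⟩
  rw [← hC, ← hS] at hdet
  have hW0 : 0 < y ^ 2 * M := by positivity
  -- The two shifts complete the square in `p` and in `q`.
  obtain ⟨e, he⟩ := exists_leafTangent_equiv hy hx hm (1 / (μ₁ * M))
    (C / (y ^ 2 * M * (1 + k ^ 2)))
  have hsig := HasLeafSignature.of_equiv (f := reducedHamiltonian μ₁ μ₂ cot)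
    ![M, 1 / μ₁ - l - 1 / (μ₁ ^ 2 * M), y ^ 2 * M * (1 + k ^ 2) ^ 2, S - C ^ 2 / (y ^ 2 * M)] e
    (fun v γ hγ h0 hl hv => by
      rw [hH hγ h0 hl hv]
      obtain ⟨hev, hv3⟩ := he v
      rw [hev, hv3, Fin.sum_univ_four]
      simp only [Matrix.cons_val]
      generalize (v : Phase).2.2 1 = d
      generalize (v : Phase).2.2 0 = x
      generalize (v : Phase).2.1 = p
      generalize (v : Phase).1 = q
      have e1 : M * (p - 1 / (μ₁ * M) * x) ^ 2 + (1 / μ₁ - l - 1 / (μ₁ ^ 2 * M)) * x ^ 2 =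
          M * p ^ 2 - 2 * p * x / μ₁ + (1 / μ₁ - l) * x ^ 2 := by
        field_simp; ring
      have e2 : y ^ 2 * M * (1 + k ^ 2) ^ 2 * (q - C / (y ^ 2 * M * (1 + k ^ 2)) * d) ^ 2 +
          (S - C ^ 2 / (y ^ 2 * M)) * d ^ 2 =
          y ^ 2 * M * ((1 + k ^ 2) * q) ^ 2 - 2 * C * ((1 + k ^ 2) * q) * d + S * d ^ 2 := by
        have : 1 + k ^ 2 ≠ 0 := by positivity
        field_simp; ring
      rw [e1, add_assoc _ (y ^ 2 * M * (1 + k ^ 2) ^ 2 * _) _, e2, hC, hS, hM]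
      ring)
  have hw3 : S - C ^ 2 / (y ^ 2 * M) = (3 * a ^ 2 * b ^ 2 - 1 - a ^ 2 - b ^ 2) *
      (y ^ 2 / (κ ^ 2 * (1 + b ^ 2) ^ 2) / (y ^ 2 * M)) := by
    have : S - C ^ 2 / (y ^ 2 * M) = (y ^ 2 * M * S - C ^ 2) / (y ^ 2 * M) := by field_simp
    rw [this, hdet]; ring
  have hpos : 0 < y ^ 2 / (κ ^ 2 * (1 + b ^ 2) ^ 2) / (y ^ 2 * M) := by positivity
  obtain ⟨c1, c2⟩ := ncard_pos_weights (w := ![M, 1 / μ₁ - l - 1 / (μ₁ ^ 2 * M),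
    y ^ 2 * M * (1 + k ^ 2) ^ 2, S - C ^ 2 / (y ^ 2 * M)]) (by simpa using hM0) hneg
    (show 0 < y ^ 2 * M * (1 + k ^ 2) ^ 2 by positivity)
  constructor
  · intro h
    obtain ⟨n1, n2⟩ := c1 (show 0 < S - C ^ 2 / (y ^ 2 * M) from hw3 ▸ mul_pos h hpos)
    rwa [n1, n2] at hsig
  · intro h
    obtain ⟨n1, n2⟩ := c2 (show S - C ^ 2 / (y ^ 2 * M) < 0 from
      hw3 ▸ mul_neg_of_neg_of_pos h hpos)
    rwa [n1, n2] at hsig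

/-! ### The critical angle -/

theorem strictMonoOn_cos_two_mul : StrictMonoOn (fun α => cos (2 * α)) (Ioo (π / 2) π) := by
  intro α hα β hβ h
  -- The reflection `x ↦ 2π - x` moves the doubled angles into `(0, π)`.
  have := strictAntiOn_cos (a := 2 * π - 2 * β) (b := 2 * π - 2 * α)
    ⟨by linarith [hβ.2], by linarith [hβ.1]⟩ ⟨by linarith [hα.2], by linarith [hα.1]⟩
    (by linarith)
  simpa [cos_two_pi_sub] using this

theorem one_sub_sq_mul_sin_sq_pos {μ : ℝ} (h0 : 0 ≤ μ) (h1 : μ < 1) (x : ℝ) :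
    0 < 1 - μ ^ 2 * sin x ^ 2 := by
  nlinarith [sin_sq_le_one x, sq_nonneg μ]

/-- The defect in the equation for the critical angle. -/
noncomputable def criticalDefect (μ α : ℝ) : ℝ :=
  cos (2 * α) - 2 * sin α ^ 2 * √(1 - μ ^ 2 * sin (2 * α) ^ 2)

/-- The polynomial satisfied by the cosine of twice the critical angle. -/
def criticalPoly (μ c : ℝ) : ℝ := 2 * c - 1 + μ ^ 2 * ((1 - c) ^ 3 * (1 + c))

/-- The derivative is `2 (1 - μ² (1 - c)² (1 + 2c))`, and `(1 - c)² (1 + 2c) = 1 - c² (3 - 2c) ≤ 1`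
on the interval. -/
theorem strictMonoOn_criticalPoly {μ : ℝ} (h0 : 0 ≤ μ) (h1 : μ < 1) :
    StrictMonoOn (criticalPoly μ) (Icc 0 1) := by
  refine strictMonoOn_of_deriv_pos (convex_Icc 0 1) (by unfold criticalPoly; fun_prop) ?_
  intro c hc
  rw [interior_Icc] at hc
  have hd : HasDerivAt (criticalPoly μ)
      (2 + μ ^ 2 * (-(3 * (1 - c) ^ 2) * (1 + c) + (1 - c) ^ 3)) c := by
    have hc := hasDerivAt_id' c
    refine (((hc.const_mul 2).sub_const 1).add
      ((((hc.const_sub 1).pow 3).mul (hc.const_add 1)).const_mul (μ ^ 2))).congr_deriv ?_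
    simp
  rw [hd.deriv]
  have h2 : μ ^ 2 < 1 := by nlinarith
  have h3 : (1 - c) ^ 2 * (1 + 2 * c) ≤ 1 := by
    have : 0 ≤ c ^ 2 * (3 - 2 * c) := mul_nonneg (sq_nonneg c) (by linarith [hc.2])
    linarith [show (1 - c) ^ 2 * (1 + 2 * c) = 1 - c ^ 2 * (3 - 2 * c) by ring]
  have h4 : 0 ≤ (1 - c) ^ 2 * (1 + 2 * c) := mul_nonneg (sq_nonneg _) (by linarith [hc.1])
  have h5 : μ ^ 2 * ((1 - c) ^ 2 * (1 + 2 * c)) < 1 := by nlinarith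
  linarith [show 2 + μ ^ 2 * (-(3 * (1 - c) ^ 2) * (1 + c) + (1 - c) ^ 3) =
    2 * (1 - μ ^ 2 * ((1 - c) ^ 2 * (1 + 2 * c))) by ring]

theorem exists_criticalPoly_eq_zero {μ : ℝ} (h0 : 0 ≤ μ) (h1 : μ < 1) :
    ∃ c ∈ Ioo (0 : ℝ) 1, criticalPoly μ c = 0 := by
  have hc : ContinuousOn (criticalPoly μ) (Icc 0 1) := by unfold criticalPoly; fun_prop
  have := intermediate_value_Ioo zero_le_one hc
  have h : (0 : ℝ) ∈ Ioo (criticalPoly μ 0) (criticalPoly μ 1) := by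
    constructor
    · simp only [criticalPoly]; nlinarith
    · norm_num [criticalPoly]
  obtain ⟨c, hc, h⟩ := this h
  exact ⟨c, hc, h⟩

/-- On the range of interest the defect is a positive multiple of the polynomial, unless both the
defect and the cosine are negative. -/
theorem criticalDefect_eq {μ α : ℝ} (h0 : 0 ≤ μ) (h1 : μ < 1) (hα : α ∈ Ioo (π / 2) π) :
    (cos (2 * α) ≤ 0 ∧ criticalDefect μ α < 0) ∨ (cos (2 * α) ∈ Ioo 0 1 ∧
      ∃ r > 0, criticalPoly μ (cos (2 * α)) = r * criticalDefect μ α) := by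
  have hs : 0 < sin α := sin_pos_of_pos_of_lt_pi (by linarith [hα.1, pi_pos]) hα.2
  have h2s : 2 * sin α ^ 2 = 1 - cos (2 * α) := by rw [cos_two_mul, cos_sq']; ring
  have hs2 : sin (2 * α) ^ 2 = 1 - cos (2 * α) ^ 2 := sin_sq _
  have hR := sqrt_pos.2 (one_sub_sq_mul_sin_sq_pos h0 h1 (2 * α))
  have hR2 := sq_sqrt (one_sub_sq_mul_sin_sq_pos h0 h1 (2 * α)).le
  have hlt : 0 < 1 - cos (2 * α) := by rw [← h2s]; positivity
  unfold criticalDefect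
  rw [h2s]
  rw [hs2] at hR hR2 ⊢
  generalize √(1 - μ ^ 2 * (1 - cos (2 * α) ^ 2)) = R at *
  generalize cos (2 * α) = c at *
  rcases le_or_gt c 0 with h | h
  · exact Or.inl ⟨h, by nlinarith [mul_pos hlt hR]⟩
  · refine Or.inr ⟨⟨h, by linarith⟩, c + (1 - c) * R, by positivity, ?_⟩
    unfold criticalPoly
    linear_combination (1 - c) ^ 2 * hR2

/-- Since `cos (2 * α)` increases on `(π/2, π)`, the single sign change of `criticalPoly` on `(0,
1)` pulls back to one of the defect. -/
theorem exists_critical {μ : ℝ} (h0 : 0 ≤ μ) (h1 : μ < 1) :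
    ∃ α ∈ Ioo (π / 2) π, criticalDefect μ α = 0 ∧
      ∀ β ∈ Ioo (π / 2) π, (β < α → criticalDefect μ β < 0) ∧
        (α < β → 0 < criticalDefect μ β) := by
  obtain ⟨c, hc, hc0⟩ := exists_criticalPoly_eq_zero h0 h1
  have hmono := strictMonoOn_criticalPoly h0 h1
  have hcI : c ∈ Icc (0 : ℝ) 1 := Ioo_subset_Icc_self hc
  obtain ⟨α, hα, hcα⟩ : ∃ α ∈ Ioo (π / 2) π, cos (2 * α) = c := by
    have hp : 0 < arccos c := arccos_pos.2 hc.2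
    have hl : arccos c < π / 2 := arccos_lt_pi_div_two.2 hc.1
    refine ⟨π - arccos c / 2, ⟨by linarith, by linarith⟩, ?_⟩
    rw [show 2 * (π - arccos c / 2) = 2 * π - arccos c by ring, cos_two_pi_sub,
      cos_arccos (by linarith [hc.1]) hc.2.le]
  refine ⟨α, hα, ?_, fun β hβ => ⟨fun h => ?_, fun h => ?_⟩⟩
  · rcases criticalDefect_eq h0 h1 hα with h | ⟨-, r, hr, h⟩
    · exact absurd hc.1 (by linarith [h.1])
    · rw [hcα, hc0] at h
      simpa [hr.ne'] using h.symm
  · have hlt := strictMonoOn_cos_two_mul hβ hα h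
    simp only [hcα] at hlt
    rcases criticalDefect_eq h0 h1 hβ with h | ⟨hI, r, hr, h⟩
    · exact h.2
    · have := hmono (Ioo_subset_Icc_self hI) hcI hlt
      rw [hc0, h] at this
      exact neg_of_mul_neg_right this hr.le
  · have hlt := strictMonoOn_cos_two_mul hα hβ h
    simp only [hcα] at hlt
    rcases criticalDefect_eq h0 h1 hβ with h | ⟨hI, r, hr, h⟩
    · exact absurd h.1 (by linarith [hc.1])
    · have := hmono hcI (Ioo_subset_Icc_self hI) hlt
      rw [hc0, h] at this
      exact pos_of_mul_pos_right this hr.le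

/-- The derivative `1 - μ cos 2α / √(1 - μ² sin² 2α)` is positive because `μ² < 1`. -/
theorem strictMono_criticalSeparation {μ : ℝ} (h0 : 0 ≤ μ) (h1 : μ < 1) :
    StrictMono (criticalSeparation μ) := by
  refine strictMono_of_deriv_pos fun α => ?_
  have hpos := one_sub_sq_mul_sin_sq_pos h0 h1 (2 * α)
  have habs : |μ * sin (2 * α)| < 1 := by
    rw [← sq_lt_one_iff_abs_lt_one]; rw [mul_pow]; linarith
  obtain ⟨hm1, hp1⟩ := abs_lt.1 habs
  have hsin : HasDerivAt (fun α => μ * sin (2 * α)) (μ * (cos (2 * α) * 2)) α := by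
    have := ((hasDerivAt_id' α).const_mul 2).sin
    simpa using this.const_mul μ
  have hd : HasDerivAt (criticalSeparation μ)
      (1 - 1 / 2 * (1 / √(1 - (μ * sin (2 * α)) ^ 2) * (μ * (cos (2 * α) * 2)))) α :=
    ((hasDerivAt_id' α).sub_const (π / 2)).sub
      (((hasDerivAt_arcsin hm1.ne' hp1.ne).comp α hsin).const_mul (1 / 2))
  rw [hd.deriv, mul_pow]
  have hR := sqrt_pos.2 hpos
  have hlt : μ * cos (2 * α) < √(1 - μ ^ 2 * sin (2 * α) ^ 2) := by
    apply lt_sqrt_of_sq_lt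
    nlinarith [sin_sq_add_cos_sq (2 * α)]
  have : μ * cos (2 * α) / √(1 - μ ^ 2 * sin (2 * α) ^ 2) < 1 := (div_lt_one hR).2 hlt
  have e : 1 - 1 / 2 * (1 / √(1 - μ ^ 2 * sin (2 * α) ^ 2) * (μ * (cos (2 * α) * 2))) =
    1 - μ * cos (2 * α) / √(1 - μ ^ 2 * sin (2 * α) ^ 2) := by ring
  rw [e]
  linarith

theorem criticalSeparation_mem {μ α : ℝ} (h0 : 0 ≤ μ) (h1 : μ < 1) (hα : α ∈ Ioo (π / 2) π) :
    criticalSeparation μ α ∈ Ioo 0 (π / 2) := by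
  have hm := strictMono_criticalSeparation h0 h1
  have hl : criticalSeparation μ (π / 2) = 0 := by
    simp [criticalSeparation, show 2 * (π / 2) = π by ring]
  have hr : criticalSeparation μ π = π / 2 := by
    simp [criticalSeparation]; ring
  exact ⟨hl ▸ hm hα.1, hr ▸ hm hα.2⟩

/-! ### Acute relative equilibria -/

theorem cot_injOn : InjOn cot (Ioo 0 π) := by
  intro x hx y hy h
  have hsx := sin_pos_of_mem_Ioo hx
  have hsy := sin_pos_of_mem_Ioo hy
  rw [cot_eq_cos_div_sin, cot_eq_cos_div_sin, div_eq_div_iff hsx.ne' hsy.ne'] at h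
  have : sin (y - x) = 0 := by rw [sin_sub]; linarith
  have := (sin_eq_zero_iff_of_lt_of_lt (by linarith [hx.2, hy.1]) (by linarith [hx.1, hy.2])).1 this
  linarith

theorem sin_two_mul_arctan (a : ℝ) : sin (2 * arctan a) = 2 * a / (1 + a ^ 2) := by
  have := cos_sq_arctan a
  rw [sin_two_mul, ← tan_mul_cos (cos_arctan_pos a).ne', tan_arctan]
  linear_combination 2 * a * this

theorem cos_two_mul_arctan (a : ℝ) : cos (2 * arctan a) = (1 - a ^ 2) / (1 + a ^ 2) := by
  have : (1 + a ^ 2) ≠ 0 := by positivity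
  rw [cos_two_mul, cos_sq_arctan]
  field_simp
  ring

/-- The distance between two bodies that the axis separates. -/
theorem eq_pi_sub_arctan {a b q : ℝ} (ha : 0 < a) (hb : 0 < b) (hq : q ∈ Ioo 0 π)
    (hc : cot q = (a * b - 1) / (a + b)) : q = π - arctan a - arctan b := by
  have h1 := arctan_pos.2 ha
  have h2 := arctan_pos.2 hb
  have h3 := arctan_lt_pi_div_two a
  have h4 := arctan_lt_pi_div_two b
  refine cot_injOn hq ⟨by linarith, by linarith⟩ ?_
  have ca := cos_arctan_pos a
  have cb := cos_arctan_pos b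
  rw [hc, show π - arctan a - arctan b = π - (arctan a + arctan b) by ring, cot_eq_cos_div_sin,
    sin_pi_sub, cos_pi_sub, sin_add, cos_add, ← tan_mul_cos ca.ne', ← tan_mul_cos cb.ne',
    tan_arctan, tan_arctan]
  field_simp
  ring

theorem mul_lt_one_of_obtuse {a b q : ℝ} (ha : 0 < a) (hb : 0 < b) (hq : q ∈ Ioo 0 π)
    (hc : cot q = (a * b - 1) / (a + b)) (h : π / 2 < q) : a * b < 1 := by
  have hcot : cot q < 0 := by
    rw [cot_eq_cos_div_sin]
    exact div_neg_of_neg_of_pos (cos_neg_of_pi_div_two_lt_of_lt h (by linarith [hq.2, pi_pos]))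
      (sin_pos_of_mem_Ioo hq)
  rw [hc] at hcot
  rcases div_neg_iff.1 hcot with h | h
  · linarith [h.2]
  · linarith [h.1]

theorem one_lt_mul_of_acute {a b q : ℝ} (ha : 0 < a) (hb : 0 < b) (hq : q ∈ Ioo 0 π)
    (hc : cot q = (a * b - 1) / (a + b)) (h : q < π / 2) : 1 < a * b := by
  have hcot : 0 < cot q := by
    rw [cot_eq_cos_div_sin]
    exact div_pos (cos_pos_of_mem_Ioo ⟨by linarith [hq.1, pi_pos], h⟩) (sin_pos_of_mem_Ioo hq)
  rw [hc] at hcot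
  rcases div_pos_iff.1 hcot with h | h
  · linarith [h.1]
  · linarith [h.2]

section

variable {a b μ : ℝ}

/-- An acute relative equilibrium is determined by the angle `arctan a` between the axis and the
lighter body. -/
theorem eq_criticalSeparation (ha : 0 < a) (hb : 1 < b) {q : ℝ} (hq : q ∈ Ioo 0 π)
    (hc : cot q = (a * b - 1) / (a + b)) (hμ : b / (1 + b ^ 2) = μ * (a / (1 + a ^ 2))) :
    q = criticalSeparation μ (π - arctan a) := by
  rw [eq_pi_sub_arctan ha (by linarith) hq hc, criticalSeparation,
    show 2 * (π - arctan a) = 2 * π - 2 * arctan a by ring, sin_two_pi_sub, sin_two_mul_arctan]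
  -- Thus `π - 2 * arctan b` lies on the principal branch of `arcsin`.
  have h1 : π / 4 < arctan b := by rw [← arctan_one]; exact arctan_strictMono hb
  have h2 := arctan_lt_pi_div_two b
  have h3 : arcsin (μ * (2 * a / (1 + a ^ 2))) = π - 2 * arctan b := by
    rw [← arcsin_sin (x := π - 2 * arctan b) (by linarith) (by linarith), sin_pi_sub,
      sin_two_mul_arctan]
    congr 1
    linear_combination -2 * hμ
  rw [mul_neg, arcsin_neg, h3]
  ring

/-- The balance law turns the radicand into `1 - sin² (2 arctan b)`, and `1 < b` fixes the sign of
its root as `-cos (2 arctan b)`. -/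
theorem criticalDefect_eq_of_tangents (hb : 1 < b)
    (hμ : b / (1 + b ^ 2) = μ * (a / (1 + a ^ 2))) :
    criticalDefect μ (π - arctan a) =
      -(1 / ((1 + a ^ 2) * (1 + b ^ 2))) * (3 * a ^ 2 * b ^ 2 - 1 - a ^ 2 - b ^ 2) := by
  have hR : √(1 - μ ^ 2 * sin (2 * (π - arctan a)) ^ 2) = (b ^ 2 - 1) / (1 + b ^ 2) := by
    have h1 : 0 ≤ (b ^ 2 - 1) / (1 + b ^ 2) := div_nonneg (by nlinarith) (by positivity)
    rw [← sqrt_sq h1]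
    congr 1
    rw [show 2 * (π - arctan a) = 2 * π - 2 * arctan a by ring, sin_two_pi_sub,
      sin_two_mul_arctan]
    have : μ ^ 2 * (-(2 * a / (1 + a ^ 2))) ^ 2 = 4 * (b / (1 + b ^ 2)) ^ 2 := by
      rw [hμ]; ring
    rw [this]
    field_simp
    ring
  rw [criticalDefect, hR, show 2 * (π - arctan a) = 2 * π - 2 * arctan a by ring, cos_two_pi_sub,
    cos_two_mul_arctan, sin_pi_sub, ← tan_mul_cos (cos_arctan_pos a).ne', tan_arctan, mul_pow,
    cos_sq_arctan]
  field_simp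
  ring

/-- The sign of the Hessian determinant is decided by the critical separation. -/
theorem shape_sign (ha : 0 < a) (hb : 0 < b) (h0 : 0 ≤ μ) (h1 : μ < 1) {q α : ℝ}
    (hα : α ∈ Ioo (π / 2) π)
    (hcrit : ∀ β ∈ Ioo (π / 2) π, (β < α → criticalDefect μ β < 0) ∧
        (α < β → 0 < criticalDefect μ β))
    (hq : q ∈ Ioo 0 π) (hc : cot q = (a * b - 1) / (a + b))
    (hμ : b / (1 + b ^ 2) = μ * (a / (1 + a ^ 2))) :
    (q < criticalSeparation μ α → 0 < 3 * a ^ 2 * b ^ 2 - 1 - a ^ 2 - b ^ 2) ∧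
      (criticalSeparation μ α < q → q < π / 2 → 3 * a ^ 2 * b ^ 2 - 1 - a ^ 2 - b ^ 2 < 0) := by
  -- The function `t / (1 + t²)` is smaller at `b` than at `a`, so `(b - a)(ab - 1) > 0`; with `ab >
  -- 1` this gives `b > a`, hence `b > 1`.
  have key (hq2 : q < π / 2) : 1 < b := by
    have hab := sub_pos.2 (one_lt_mul_of_acute ha hb hq hc hq2)
    have hlt : b / (1 + b ^ 2) < a / (1 + a ^ 2) := by
      rw [hμ]
      have : 0 < a / (1 + a ^ 2) := by positivity
      nlinarith
    rw [div_lt_div_iff₀ (by positivity) (by positivity)] at hlt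
    have : 0 < (b - a) * (a * b - 1) := by linear_combination hlt
    have := pos_of_mul_pos_left this hab.le
    nlinarith
  have hmem : π - arctan a ∈ Ioo (π / 2) π :=
    ⟨by linarith [arctan_lt_pi_div_two a], by linarith [arctan_pos.2 ha]⟩
  have hm := strictMono_criticalSeparation h0 h1
  have hr : 0 < 1 / ((1 + a ^ 2) * (1 + b ^ 2)) := by positivity
  constructor
  · intro h
    have hb1 := key (h.trans (criticalSeparation_mem h0 h1 hα).2)
    rw [eq_criticalSeparation ha hb1 hq hc hμ, hm.lt_iff_lt] at h
    have := (hcrit _ hmem).1 h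
    rw [criticalDefect_eq_of_tangents hb1 hμ] at this
    exact pos_of_mul_pos_right (by linarith) hr.le
  · intro h hq2
    have hb1 := key hq2
    rw [eq_criticalSeparation ha hb1 hq hc hμ, hm.lt_iff_lt] at h
    have := (hcrit _ hmem).2 h
    rw [criticalDefect_eq_of_tangents hb1 hμ] at this
    exact neg_of_mul_neg_right (by linarith) hr.le

/-- From `a² + b² ≥ 2ab`, the expression is at most `(3ab + 1)(ab - 1)`. -/
theorem shape_neg_of_mul_lt_one (ha : 0 < a) (hb : 0 < b) (h : a * b < 1) :
    3 * a ^ 2 * b ^ 2 - 1 - a ^ 2 - b ^ 2 < 0 := by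
  have hab : 0 < a * b := by positivity
  nlinarith [sq_nonneg (a - b), mul_pos (sub_pos.2 h) hab]

end

/-! ### The main theorem -/

/-- Equal masses give `(a - b)(ab - 1) = 0`. If `ab = 1` then `D = -(a - b)²`, and `a = b = 1` would
be isosceles; if `a = b` then `D = (3a² + 1)(a² - 1)`. -/
theorem signature_of_eq_masses {μ : ℝ} (h : 0 < μ) {z : Phase}
    (hz : IsRelativeEquilibrium μ μ cot z) :
    (z.1 = π / 2 → ¬ IsIsosceles μ μ z →
      HasLeafSignature (reducedHamiltonian μ μ cot) z 2 2) ∧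
    (z.1 < π / 2 → HasLeafSignature (reducedHamiltonian μ μ cot) z 3 1) ∧
    (π / 2 < z.1 → HasLeafSignature (reducedHamiltonian μ μ cot) z 2 2) := by
  obtain ⟨a, b, κ, ha, hb, hκ, hμ₁, hμ₂, hk, hm⟩ := hz.exists_tangents h h
  obtain ⟨s1, s2⟩ := hz.hasLeafSignature h h ha hb hκ hμ₁ hμ₂ hk hm
  have hs := sin_ne_zero_of_mem_reducedSpace hz.1
  refine ⟨fun hq hiso => s2 ?_, fun hq => s1 ?_, fun hq => s2 ?_⟩
  · have hcot : cot z.1 = 0 := by rw [hq, cot_eq_cos_div_sin]; simp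
    have hab : a * b = 1 := by
      rw [hcot, eq_comm, div_eq_zero_iff] at hk
      rcases hk with hk | hk <;> linarith
    have ha1 : a ≠ 1 := by
      rintro rfl
      refine hiso ?_
      rw [IsIsosceles, angularVelocity, velocities_eq h.ne' h.ne' hs, hcot, hm, hq]
      simp [pos₁, pos₂, dotProduct, Fin.sum_univ_three]
    have hne : a - b ≠ 0 := by
      intro hne
      have : (a - 1) * (a + 1) = 0 := by
        rw [show b = a by linarith] at hab; linarith
      rcases mul_eq_zero.1 this with h | h
      · exact ha1 (by linarith)
      · linarith
    have : 0 < (a - b) ^ 2 := by positivity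
    nlinarith
  · have hab := one_lt_mul_of_acute ha hb hz.1 hk hq
    have heq : a = b := by
      have h1 := hμ₁.symm.trans hμ₂
      rw [div_eq_div_iff ha.ne' hb.ne'] at h1
      have : κ * ((a - b) * (a * b - 1)) = 0 := by linear_combination h1
      rcases mul_eq_zero.1 this with h | h
      · exact absurd h hκ.ne'
      · rcases mul_eq_zero.1 h with h | h <;> linarith
    subst heq
    nlinarith
  · exact shape_neg_of_mul_lt_one ha hb (mul_lt_one_of_obtuse ha hb hz.1 hk hq)

theorem isCriticalAxisAngle_iff {μ α : ℝ} :
    IsCriticalAxisAngle μ α ↔ α ∈ Ioo (π / 2) π ∧ criticalDefect μ α = 0 := by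
  rw [IsCriticalAxisAngle, criticalDefect, sub_eq_zero]

theorem mass_ratio_eq {μ₁ μ₂ a b κ : ℝ} (ha : 0 < a) (hb : 0 < b) (hκ : 0 < κ)
    (h₁ : μ₁ = κ * (1 + a ^ 2) / a) (h₂ : μ₂ = κ * (1 + b ^ 2) / b) :
    b / (1 + b ^ 2) = μ₁ / μ₂ * (a / (1 + a ^ 2)) := by
  rw [h₁, h₂]
  field_simp

end TwoBodySphere

theorem mainTheorem7 (μ₁ μ₂ : ℝ) (hμ₁ : 0 < μ₁) (hμ₂ : 0 < μ₂) :
    (μ₁ = μ₂ →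
      ∀ z : TwoBodySphere.Phase, TwoBodySphere.IsRelativeEquilibrium μ₁ μ₂ Real.cot z →
        (z.1 = π / 2 → ¬ TwoBodySphere.IsIsosceles μ₁ μ₂ z →
          TwoBodySphere.HasLeafSignature
            (TwoBodySphere.reducedHamiltonian μ₁ μ₂ Real.cot) z 2 2) ∧
        (TwoBodySphere.IsIsosceles μ₁ μ₂ z → z.1 < π / 2 →
          TwoBodySphere.HasLeafSignature
            (TwoBodySphere.reducedHamiltonian μ₁ μ₂ Real.cot) z 3 1) ∧
        (TwoBodySphere.IsIsosceles μ₁ μ₂ z → π / 2 < z.1 →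
          TwoBodySphere.HasLeafSignature
            (TwoBodySphere.reducedHamiltonian μ₁ μ₂ Real.cot) z 2 2)) ∧
    (μ₁ ≠ μ₂ →
      ∃ α q : ℝ,
        TwoBodySphere.IsCriticalAxisAngle (min μ₁ μ₂ / max μ₁ μ₂) α ∧
        (∀ β : ℝ, TwoBodySphere.IsCriticalAxisAngle (min μ₁ μ₂ / max μ₁ μ₂) β → β = α) ∧
        q = TwoBodySphere.criticalSeparation (min μ₁ μ₂ / max μ₁ μ₂) α ∧
        q ∈ Set.Ioo 0 (π / 2) ∧
        ∀ z : TwoBodySphere.Phase, TwoBodySphere.IsRelativeEquilibrium μ₁ μ₂ Real.cot z →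
          (z.1 < q →
            TwoBodySphere.HasLeafSignature
              (TwoBodySphere.reducedHamiltonian μ₁ μ₂ Real.cot) z 3 1) ∧
          (q < z.1 → z.1 < π / 2 →
            TwoBodySphere.HasLeafSignature
              (TwoBodySphere.reducedHamiltonian μ₁ μ₂ Real.cot) z 2 2) ∧
          (π / 2 < z.1 →
            TwoBodySphere.HasLeafSignature
              (TwoBodySphere.reducedHamiltonian μ₁ μ₂ Real.cot) z 2 2)) := by
  constructor
  · rintro rfl z hz
    obtain ⟨s1, s2, s3⟩ := TwoBodySphere.signature_of_eq_masses hμ₁ hz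
    exact ⟨s1, fun _ => s2, fun _ => s3⟩
  · intro hne
    obtain ⟨μ, hμ⟩ : ∃ μ, μ = min μ₁ μ₂ / max μ₁ μ₂ := ⟨_, rfl⟩
    have hmax : 0 < max μ₁ μ₂ := lt_max_of_lt_left hμ₁
    have h0 : 0 ≤ μ := by rw [hμ]; exact (div_pos (lt_min hμ₁ hμ₂) hmax).le
    have h1 : μ < 1 := by rw [hμ, div_lt_one hmax]; exact min_lt_max.2 hne
    rw [← hμ]
    obtain ⟨α, hα, hα0, hcrit⟩ := TwoBodySphere.exists_critical h0 h1
    refine ⟨α, _, TwoBodySphere.isCriticalAxisAngle_iff.2 ⟨hα, hα0⟩, fun β hβ => ?_, rfl,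
      TwoBodySphere.criticalSeparation_mem h0 h1 hα, fun z hz => ?_⟩
    · obtain ⟨hβ, hβ0⟩ := TwoBodySphere.isCriticalAxisAngle_iff.1 hβ
      rcases lt_trichotomy β α with h | h | h
      · exact absurd hβ0 ((hcrit β hβ).1 h).ne
      · exact h
      · exact absurd hβ0 ((hcrit β hβ).2 h).ne'
    · obtain ⟨a, b, κ, ha, hb, hκ, e₁, e₂, hk, hm⟩ := hz.exists_tangents hμ₁ hμ₂
      obtain ⟨s1, s2⟩ := hz.hasLeafSignature hμ₁ hμ₂ ha hb hκ e₁ e₂ hk hm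
      have hobt (h : π / 2 < z.1) := s2 (TwoBodySphere.shape_neg_of_mul_lt_one ha hb
        (TwoBodySphere.mul_lt_one_of_obtuse ha hb hz.1 hk h))
      rcases lt_or_gt_of_ne hne with h | h
      · rw [min_eq_left h.le, max_eq_right h.le] at hμ
        have hr := TwoBodySphere.mass_ratio_eq ha hb hκ e₁ e₂
        rw [← hμ] at hr
        obtain ⟨t1, t2⟩ := TwoBodySphere.shape_sign ha hb h0 h1 hα hcrit hz.1 hk hr
        exact ⟨fun h => s1 (t1 h), fun h h' => s2 (t2 h h'), hobt⟩
      · rw [min_eq_right h.le, max_eq_left h.le] at hμ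
        -- Now the second body is the lighter one. The roles of `a` and `b` are exchanged, and `D`
        -- is symmetric in them.
        have hr := TwoBodySphere.mass_ratio_eq hb ha hκ e₂ e₁
        rw [← hμ] at hr
        have hk' : Real.cot z.1 = (b * a - 1) / (b + a) := by rw [hk, mul_comm, add_comm]
        obtain ⟨t1, t2⟩ := TwoBodySphere.shape_sign hb ha h0 h1 hα hcrit hz.1 hk' hr
        exact ⟨fun h => s1 (by linarith [t1 h]), fun h h' => s2 (by linarith [t2 h h']), hobt⟩
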